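/- Let $(X,\mu_0)$ and $(Y,\mu_1)$ be arbitrary probability spaces. Let $\kappa,\kappa'\in L^\infty(\mu_0\otimes\mu_1)$ be real-valued functions such that $d\mathcal R=e^{-\kappa}\,d(\mu_0\otimes\mu_1)$ and $d\mathcal R'=e^{-\kappa'}\,d(\mu_0\otimes\mu_1)$ are probability measures on $X\times Y$. For a probability measure $\mathcal Q$ on $X\times Y$, the static Schrödinger bridge $\pi^{\mathcal Q}$ with marginals $\mu_0,\mu_1$ and reference measure $\mathcal Q$ is the minimizer of the relative entropy $D_{\mathrm{KL}}(\mathcal H\,\|\,\mathcal Q)$ (equal to $\int\log\frac{d\mathcal H}{d\mathcal Q}\,d\mathcal H$ if $\mathcal H\ll\mathcal Q$ and to $+\infty$ otherwise) over all couplings $\mathcal H$ of $\mu_0$ and $\mu_1$. The Hellinger distance is $$d_H(P,Q)=\left(\int\left(\sqrt{\tfrac{dP}{d\sigma}}-\sqrt{\tfrac{dQ}{d\sigma}}\right)^2d\sigma\right)^{1/2}$$ for any $\sigma$-finite measure $\sigma$ with $P,Q\ll\sigma$ (the value does not depend on $\sigma$). Then the static Schrödinger bridges $\pi^{\mathcal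 R}$ and $\pi^{\mathcal R'}$ exist and are unique, and $$d_H\bigl(\pi^{\mathcal R},\pi^{\mathcal R'}\bigr)\le\exp\left(\tfrac32\max\bigl\{\|\kappa^+\|_\infty,\|(\kappa')^+\|_\infty\bigr\}\right)d_H(\mathcal R,\mathcal R'),$$ where $\kappa^+=\max(\kappa,0)$ and $\|\cdot\|_\infty$ is the essential supremum norm with respect to $\mu_0\otimes\mu_1$. -/

import Mathlib

open MeasureTheory InformationTheory
open scoped ENNReal

/-- `π` is a coupling of `μ₀` and `μ₁`: a measure on the product space whose marginals are
`μ₀` and `μ₁`. -/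
structure IsCoupling {X Y : Type*} [MeasurableSpace X] [MeasurableSpace Y]
    (π : Measure (X × Y)) (μ₀ : Measure X) (μ₁ : Measure Y) : Prop where
  fst_eq : π.fst = μ₀
  snd_eq : π.snd = μ₁

/-- `π` is a static Schrödinger bridge with marginals `μ₀`, `μ₁` and reference measure `R`:
it minimizes the relative entropy `H ↦ D_KL(H ‖ R)` among all couplings `H` of `μ₀` and `μ₁`.
For probability measures `klDiv H R` is `∫ log (dH/dR) dH` if `H ≪ R` and `∞` otherwise. -/
structure IsStaticSchrodingerBridge {X Y : Type*} [MeasurableSpace X] [MeasurableSpace Y]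
    (μ₀ : Measure X) (μ₁ : Measure Y) (R π : Measure (X × Y)) : Prop where
  isCoupling : IsCoupling π μ₀ μ₁
  klDiv_le : ∀ H : Measure (X × Y), IsCoupling H μ₀ μ₁ → klDiv π R ≤ klDiv H R

/-- The Hellinger integral `(∫ (√(dP/dσ) - √(dQ/dσ))² dσ)^(1/2)` computed with the base
measure `σ`. -/
noncomputable def hellingerIntegral {Z : Type*} [MeasurableSpace Z]
    (σ P Q : Measure Z) : ℝ :=
  Real.sqrt (∫ z, (Real.sqrt (P.rnDeriv σ z).toReal - Real.sqrt (Q.rnDeriv σ z).toReal) ^ 2 ∂σ)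

/-- The Hellinger distance of two finite measures, computed with the base measure `P + Q`, which
dominates both. By `hellingerDist_eq_hellingerIntegral` every dominating base measure gives
the same value. -/
noncomputable def hellingerDist {Z : Type*} [MeasurableSpace Z] (P Q : Measure Z) : ℝ :=
  hellingerIntegral (P + Q) P Q

/-- The Hellinger distance does not depend on the dominating base measure. -/
theorem hellingerDist_eq_hellingerIntegral {Z : Type*} [MeasurableSpace Z]
    (σ P Q : Measure Z) [SigmaFinite σ] [IsFiniteMeasure P] [IsFiniteMeasure Q]
    (hP : P ≪ σ) (hQ : Q ≪ σ) :
    hellingerDist P Q = hellingerIntegral σ P Q := by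
  have hS : P + Q ≪ σ := Measure.AbsolutelyContinuous.add_left hP hQ
  have hPS : P ≪ P + Q := Measure.absolutelyContinuous_of_le (Measure.le_add_right le_rfl)
  have hQS : Q ≪ P + Q := Measure.absolutelyContinuous_of_le (Measure.le_add_left le_rfl)
  unfold hellingerDist hellingerIntegral
  congr 1
  rw [← integral_rnDeriv_smul hS]
  apply integral_congr_ae
  filter_upwards [Measure.rnDeriv_mul_rnDeriv (κ := σ) hPS,
    Measure.rnDeriv_mul_rnDeriv (κ := σ) hQS] with z h1 h2
  rw [← h1, ← h2]
  simp only [Pi.mul_apply, ENNReal.toReal_mul, smul_eq_mul,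
    Real.sqrt_mul ENNReal.toReal_nonneg]
  have h := Real.sq_sqrt (ENNReal.toReal_nonneg (a := (P + Q).rnDeriv σ z))
  linear_combination
    -(Real.sqrt (P.rnDeriv (P + Q) z).toReal - Real.sqrt (Q.rnDeriv (P + Q) z).toReal) ^ 2 * h

/-- The measure `e^(-κ) d(μ₀ ⊗ μ₁)`. -/
noncomputable def costMeasure {X Y : Type*} [MeasurableSpace X] [MeasurableSpace Y]
    (μ₀ : Measure X) (μ₁ : Measure Y) (κ : X × Y → ℝ) : Measure (X × Y) :=
  (μ₀.prod μ₁).withDensity fun z => ENNReal.ofReal (Real.exp (-κ z))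

/-- `‖κ⁺‖_∞`, the essential supremum norm with respect to `σ` of the positive part of `κ`. -/
noncomputable def posPartSupNorm {Z : Type*} [MeasurableSpace Z] (σ : Measure Z)
    (κ : Z → ℝ) : ℝ :=
  (eLpNorm (fun z => max (κ z) 0) ∞ σ).toReal

/-! Let `M` be the larger of the two norms. With respect to `μ₀ ⊗ μ₁` the bridges have densities
`exp (f - k)` and `exp (g - l)`, where `k`, `l` are versions of the costs and `f = φ ⊕ ψ`, `g = φ' ⊕
ψ'` are sums of potentials. Since `f, g ≤ 2M`, the pointwise inequality `sq_exp_sub_exp_le` bounds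
the squared Hellinger integrand of the bridges by `exp (2M)` times that of the references plus `(f -
g)(exp (f - k) - exp (g - l)) / 2`. The extra term integrates to zero: `f - g` splits into a
function of `x` and a function of `y`, and both bridges have the same marginals. This gives the
factor `exp M`, which is at most `exp (3M/2)`.

The bound on `f` comes from the Schrödinger system. Each marginal equation bounds one potential by
`M` minus the log-integral of the exponential of the other. By Jensen the two bounds add up to `f ≤
2M - E`, where `E` is the integral of the potentials; `E` is the relative entropy of the bridge,
hence nonnegative.

Potentials exist because the Sinkhorn map contracts projective oscillation
(`integral_mul_contraction`), so normalised iterates converge. Existence and uniqueness of the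
bridge follow from the Pythagorean identity `IsCoupling.klDiv_tilted`. -/

/-! ### The pointwise inequality -/

/-- Right side minus left side is a quadratic form in `(x, y)`. It is nonnegative because its `x²`
coefficient is positive and its determinant is nonnegative. -/
theorem sq_sub_le_log_mul_of_lt {a b : ℝ} (x y : ℝ) (hb : 0 < b) (hba : b < a) (ha : a ≤ 1) :
    (a * x - b * y) ^ 2 ≤ Real.log (a / b) * ((a * x) ^ 2 - (b * y) ^ 2) + (x - y) ^ 2 := by
  have ha0 : 0 < a := hb.trans hba
  set L := Real.log (a / b) with hL
  have hL0 : 0 < L := Real.log_pos ((one_lt_div hb).2 hba)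
  have h1 : b * L ≤ a - b := by
    have := Real.log_le_sub_one_of_pos (div_pos ha0 hb)
    calc b * L ≤ b * (a / b - 1) := by gcongr
      _ = a - b := by field_simp
  have h2 : a - b ≤ a * L := by
    have := Real.one_sub_inv_le_log_of_pos (div_pos ha0 hb)
    calc a - b = a * (1 - (a / b)⁻¹) := by field_simp
      _ ≤ a * L := by gcongr
  -- Nonnegativity of the determinant: `L²a²b² ≤ Lb(a - b)` and `(a - b)² ≤ La(a - b)` add up to the
  -- claim.
  have h3 : (a - b) ^ 2 + L ^ 2 * a ^ 2 * b ^ 2 ≤ L * (a ^ 2 - b ^ 2) := by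
    have e1 : L ^ 2 * a ^ 2 * b ^ 2 ≤ L ^ 2 * b ^ 2 := by
      have : a ^ 2 ≤ 1 := pow_le_one₀ ha0.le ha
      have : 0 ≤ L ^ 2 * b ^ 2 := by positivity
      nlinarith
    have e2 : L * b * (b * L) ≤ L * b * (a - b) := by gcongr
    have e3 : (a - b) * (a - b) ≤ (a * L) * (a - b) := by
      gcongr
    nlinarith
  have hα : 0 < 1 - a ^ 2 + L * a ^ 2 := by
    have : a ^ 2 ≤ 1 := pow_le_one₀ ha0.le ha
    have : 0 < L * a ^ 2 := by positivity
    linarith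
  have h4 : 0 ≤ (1 - a ^ 2 + L * a ^ 2) *
      (L * ((a * x) ^ 2 - (b * y) ^ 2) + (x - y) ^ 2 - (a * x - b * y) ^ 2) := by
    have : (1 - a ^ 2 + L * a ^ 2) *
        (L * ((a * x) ^ 2 - (b * y) ^ 2) + (x - y) ^ 2 - (a * x - b * y) ^ 2) =
        ((1 - a ^ 2 + L * a ^ 2) * x + (a * b - 1) * y) ^ 2 +
        (L * (a ^ 2 - b ^ 2) - ((a - b) ^ 2 + L ^ 2 * a ^ 2 * b ^ 2)) * y ^ 2 := by ring
    rw [this]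
    have := sub_nonneg.2 h3
    positivity
  have := nonneg_of_mul_nonneg_right h4 hα
  linarith

/-- Exchanging `(a, x)` with `(b, y)` flips the sign of both factors in the logarithmic term, so the
inequality is symmetric. -/
theorem sq_sub_le_log_mul {a b : ℝ} (x y : ℝ) (ha0 : 0 < a) (ha : a ≤ 1) (hb0 : 0 < b)
    (hb : b ≤ 1) :
    (a * x - b * y) ^ 2 ≤ Real.log (a / b) * ((a * x) ^ 2 - (b * y) ^ 2) + (x - y) ^ 2 := by
  rcases lt_trichotomy a b with h | rfl | h
  · have := sq_sub_le_log_mul_of_lt y x ha0 h hb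
    rw [← inv_div, Real.log_inv] at this
    linarith
  · rw [div_self ha0.ne', Real.log_one, zero_mul, zero_add, ← mul_sub, mul_pow]
    exact mul_le_of_le_one_left (sq_nonneg _) (pow_le_one₀ ha0.le ha)
  · exact sq_sub_le_log_mul_of_lt x y hb0 h ha

/-- The pointwise Hellinger estimate for two densities `exp (f - k)` and `exp (g - l)`, where
the exponents `f`, `g` of the relative densities are at most `2 * M`. -/
theorem sq_exp_sub_exp_le {f g M : ℝ} (k l : ℝ) (hf : f ≤ 2 * M) (hg : g ≤ 2 * M) :
    (Real.exp ((f - k) / 2) - Real.exp ((g - l) / 2)) ^ 2 ≤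
      (1 / 2) * ((f - g) * (Real.exp (f - k) - Real.exp (g - l))) +
        Real.exp (2 * M) * (Real.exp (-k / 2) - Real.exp (-l / 2)) ^ 2 := by
  -- The shift by `M` makes both factors at most 1; multiplying by `exp (2M)` afterwards undoes it.
  -- The logarithm of the quotient is `(f - g) / 2`.
  have h := sq_sub_le_log_mul (a := Real.exp (f / 2 - M)) (b := Real.exp (g / 2 - M))
    (Real.exp (-k / 2)) (Real.exp (-l / 2)) (Real.exp_pos _)
    (Real.exp_le_one_iff.2 (by linarith)) (Real.exp_pos _) (Real.exp_le_one_iff.2 (by linarith))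
  rw [← Real.exp_sub, Real.log_exp, ← Real.exp_add, ← Real.exp_add] at h
  have h' := mul_le_mul_of_nonneg_left h (Real.exp_pos (2 * M)).le
  have e : ∀ s t : ℝ, Real.exp ((s - t) / 2) = Real.exp M * Real.exp (s / 2 - M + -t / 2) := by
    intro s t
    rw [← Real.exp_add]
    ring_nf
  have e' : ∀ s t : ℝ, Real.exp (s - t) = Real.exp (2 * M) * Real.exp (s / 2 - M + -t / 2) ^ 2 := by
    intro s t
    rw [← Real.exp_nat_mul, ← Real.exp_add]
    push_cast
    ring_nf
  have e2 : Real.exp (2 * M) = Real.exp M ^ 2 := by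
    rw [← Real.exp_nat_mul]; norm_cast
  rw [e, e, e', e']
  rw [e2] at h' ⊢
  linarith

/-! ### Functions bounded above and away from zero -/

/-- A measurable function with values in `[a, b]` for some `0 < a`. -/
structure IsPosBounded {X : Type*} [MeasurableSpace X] (u : X → ℝ) : Prop where
  measurable : Measurable u
  exists_bounds : ∃ a b : ℝ, 0 < a ∧ ∀ x, a ≤ u x ∧ u x ≤ b

theorem IsPosBounded.pos {X : Type*} [MeasurableSpace X] {u : X → ℝ} (hu : IsPosBounded u)
    (x : X) : 0 < u x := by
  obtain ⟨a, b, ha, h⟩ := hu.exists_bounds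
  exact ha.trans_le (h x).1

theorem IsPosBounded.integrable {X : Type*} [MeasurableSpace X] {u : X → ℝ}
    (hu : IsPosBounded u) (μ : Measure X) [IsFiniteMeasure μ] : Integrable u μ := by
  obtain ⟨a, b, ha, h⟩ := hu.exists_bounds
  refine Integrable.of_bound hu.measurable.aestronglyMeasurable b (ae_of_all _ fun x => ?_)
  rw [Real.norm_of_nonneg (hu.pos x).le]
  exact (h x).2

theorem IsPosBounded.mul {X : Type*} [MeasurableSpace X] {u v : X → ℝ}
    (hu : IsPosBounded u) (hv : IsPosBounded v) : IsPosBounded fun x => u x * v x := by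
  obtain ⟨a, b, ha, h⟩ := hu.exists_bounds
  obtain ⟨a', b', ha', h'⟩ := hv.exists_bounds
  exact ⟨hu.measurable.mul hv.measurable, a * a', b * b', mul_pos ha ha', fun x =>
    ⟨mul_le_mul (h x).1 (h' x).1 ha'.le (hu.pos x).le,
      mul_le_mul (h x).2 (h' x).2 (hv.pos x).le ((hu.pos x).le.trans (h x).2)⟩⟩

theorem IsPosBounded.comp {X Y : Type*} [MeasurableSpace X] [MeasurableSpace Y] {u : Y → ℝ}
    (hu : IsPosBounded u) {g : X → Y} (hg : Measurable g) : IsPosBounded fun x => u (g x) := by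
  obtain ⟨a, b, ha, h⟩ := hu.exists_bounds
  exact ⟨hu.measurable.comp hg, a, b, ha, fun x => h (g x)⟩

theorem isPosBounded_const {X : Type*} [MeasurableSpace X] {c : ℝ} (hc : 0 < c) :
    IsPosBounded fun _ : X => c :=
  ⟨measurable_const, c, c, hc, fun _ => ⟨le_rfl, le_rfl⟩⟩

theorem IsPosBounded.inv {X : Type*} [MeasurableSpace X] {u : X → ℝ}
    (hu : IsPosBounded u) : IsPosBounded fun x => (u x)⁻¹ := by
  obtain ⟨a, b, ha, h⟩ := hu.exists_bounds
  -- On an empty space `b` need not be positive, hence the maximum with 1.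
  refine ⟨hu.measurable.inv, (max b 1)⁻¹, a⁻¹, by positivity, fun x => ⟨?_, ?_⟩⟩
  · exact inv_anti₀ (hu.pos x) ((h x).2.trans (le_max_left _ _))
  · exact inv_anti₀ ha (h x).1

theorem IsPosBounded.abs_log_le {X : Type*} [MeasurableSpace X] {u : X → ℝ}
    (hu : IsPosBounded u) : ∃ C : ℝ, ∀ x, |Real.log (u x)| ≤ C := by
  obtain ⟨a, b, ha, h⟩ := hu.exists_bounds
  refine ⟨max (-Real.log a) (Real.log b), fun x => abs_le'.2 ⟨?_, ?_⟩⟩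
  · exact (Real.log_le_log (hu.pos x) (h x).2).trans (le_max_right _ _)
  · exact (neg_le_neg (Real.log_le_log ha (h x).1)).trans (le_max_left _ _)

theorem IsPosBounded.integrable_log {X : Type*} [MeasurableSpace X] {u : X → ℝ}
    (hu : IsPosBounded u) (μ : Measure X) [IsFiniteMeasure μ] :
    Integrable (fun x => Real.log (u x)) μ := by
  obtain ⟨C, hC⟩ := hu.abs_log_le
  exact Integrable.of_bound (Real.measurable_log.comp hu.measurable).aestronglyMeasurable C
    (ae_of_all _ hC)

/-! ### Sinkhorn iteration and the Schrödinger system -/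

section Sinkhorn

variable {X Y : Type*} [MeasurableSpace X] [MeasurableSpace Y]

theorem IsPosBounded.left {k : X × Y → ℝ} (hk : IsPosBounded k) (y : Y) :
    IsPosBounded fun x => k (x, y) :=
  hk.comp (measurable_id.prodMk measurable_const)

theorem IsPosBounded.right {k : X × Y → ℝ} (hk : IsPosBounded k) (x : X) :
    IsPosBounded fun y => k (x, y) :=
  hk.comp (measurable_const.prodMk measurable_id)

theorem IsPosBounded.swap {k : X × Y → ℝ} (hk : IsPosBounded k) :
    IsPosBounded fun z : Y × X => k z.swap :=
  hk.comp measurable_swap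

theorem IsPosBounded.integral_pos {u : X → ℝ} (hu : IsPosBounded u) (μ : Measure X)
    [IsProbabilityMeasure μ] : 0 < ∫ x, u x ∂μ := by
  obtain ⟨a, b, ha, h⟩ := hu.exists_bounds
  refine ha.trans_le ?_
  simpa using integral_mono (integrable_const a) (hu.integrable μ) fun x => (h x).1

/-- One half step of the Sinkhorn iteration with kernel `k`. -/
noncomputable def sinkhornStep {X Y : Type*} [MeasurableSpace X] (μ : Measure X) (k : X × Y → ℝ)
    (u : X → ℝ) (y : Y) : ℝ :=
  (∫ x, k (x, y) * u x ∂μ)⁻¹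

theorem sinkhornStep_const_mul {X Y : Type*} [MeasurableSpace X] (μ : Measure X) (k : X × Y → ℝ)
    (c : ℝ) (u : X → ℝ) :
    sinkhornStep μ k (fun x => c * u x) = fun y => c⁻¹ * sinkhornStep μ k u y := by
  ext y
  simp only [sinkhornStep]
  rw [← mul_inv, ← integral_const_mul]
  congr 2
  ext x
  ring

variable {μ : Measure X} [IsProbabilityMeasure μ] {k : X × Y → ℝ}

theorem isPosBounded_integral_mul (hk : IsPosBounded k) {u : X → ℝ} (hu : IsPosBounded u) :
    IsPosBounded fun y => ∫ x, k (x, y) * u x ∂μ := by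
  have hw : IsPosBounded fun z : X × Y => k z * u z.1 := hk.mul (hu.comp measurable_fst)
  refine ⟨(hw.measurable.stronglyMeasurable.integral_prod_left'
    (f := fun z : X × Y => k z * u z.1)).measurable, ?_⟩
  obtain ⟨a, b, ha, h⟩ := hw.exists_bounds
  refine ⟨a, b, ha, fun y => ⟨?_, ?_⟩⟩
  · simpa using integral_mono (integrable_const a) ((hw.left y).integrable μ) fun x => (h (x, y)).1
  · simpa using integral_mono ((hw.left y).integrable μ) (integrable_const b) fun x => (h (x, y)).2

theorem IsPosBounded.sinkhornStep (hk : IsPosBounded k) {u : X → ℝ} (hu : IsPosBounded u) :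
    IsPosBounded (sinkhornStep μ k u) :=
  (isPosBounded_integral_mul hk hu).inv

/-- The kernel varies by a factor of at most `L / l`, hence so do its integrals. The bound does not
depend on `u`, which keeps all normalised iterates in one fixed interval. -/
theorem sinkhornStep_le_mul (hk : IsPosBounded k) {l L : ℝ} (hl : 0 < l)
    (hlk : ∀ z, l ≤ k z) (hkL : ∀ z, k z ≤ L) {u : X → ℝ} (hu : IsPosBounded u) (y y' : Y) :
    sinkhornStep μ k u y ≤ L / l * sinkhornStep μ k u y' := by
  have h1 := (isPosBounded_integral_mul (μ := μ) hk hu).pos y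
  have h2 := (isPosBounded_integral_mul (μ := μ) hk hu).pos y'
  have h : ∫ x, k (x, y') * u x ∂μ ≤ L / l * ∫ x, k (x, y) * u x ∂μ := by
    rw [← integral_const_mul]
    refine integral_mono (((hk.left y').mul hu).integrable μ)
      ((((hk.left y).mul hu).integrable μ).const_mul _) fun x => ?_
    have : k (x, y') ≤ L / l * k (x, y) := by
      have hL : 0 ≤ L := (hk.pos (x, y)).le.trans (hkL _)
      calc k (x, y') ≤ L := hkL _
        _ = L / l * l := by field_simp
        _ ≤ L / l * k (x, y) := by gcongr; exact hlk _
    simpa only [mul_assoc] using mul_le_mul_of_nonneg_right this (hu.pos x).le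
  unfold sinkhornStep
  rw [← div_eq_mul_inv, le_div_iff₀ h2, inv_mul_le_iff₀ h1, mul_comm]
  exact h

/-- Birkhoff's contraction estimate: integration against a kernel with values in `[l, L]`
contracts the projective oscillation of the quotient of two positive functions. -/
theorem integral_mul_contraction (hk : IsPosBounded k) {l L : ℝ} (hl : 0 < l)
    (hlk : ∀ z, l ≤ k z) (hkL : ∀ z, k z ≤ L) {u₁ u₂ : X → ℝ} (hu₁ : IsPosBounded u₁)
    (hu₂ : IsPosBounded u₂) {ρ : ℝ} (hρ : 0 ≤ ρ)
    (h : ∀ x x', u₁ x * u₂ x' ≤ (1 + ρ) * (u₁ x' * u₂ x)) (y y' : Y) :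
    (∫ x, k (x, y) * u₁ x ∂μ) * (∫ x, k (x, y') * u₂ x ∂μ) ≤
      (1 + (1 - l / L) * ρ) *
        ((∫ x, k (x, y') * u₁ x ∂μ) * ∫ x, k (x, y) * u₂ x ∂μ) := by
  have : Nonempty X := nonempty_of_isProbabilityMeasure μ
  have x₀ : X := Classical.arbitrary X
  have hL : 0 < L := (hk.pos (x₀, y)).trans_le (hkL _)
  have hlL : l ≤ L := (hlk (x₀, y)).trans (hkL _)
  set c := l / L with hc
  have hc0 : 0 ≤ c := by positivity
  have hc1 : c ≤ 1 := (div_le_one hL).2 hlL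
  -- `α` is the infimum of `u₁ / u₂`; the oscillation hypothesis bounds the quotient above by `(1 +
  -- ρ) * α`.
  obtain ⟨α, hα0, hα, hβ⟩ : ∃ α : ℝ, 0 ≤ α ∧ (∀ x, α * u₂ x ≤ u₁ x) ∧
      ∀ x, u₁ x ≤ (1 + ρ) * α * u₂ x := by
    have hbdd : BddBelow (Set.range fun x => u₁ x / u₂ x) :=
      ⟨0, by rintro _ ⟨x, rfl⟩; exact (div_pos (hu₁.pos x) (hu₂.pos x)).le⟩
    refine ⟨⨅ x, u₁ x / u₂ x,
      Real.iInf_nonneg fun x => (div_pos (hu₁.pos x) (hu₂.pos x)).le, fun x => ?_, fun x => ?_⟩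
    · exact (le_div_iff₀ (hu₂.pos x)).1 (ciInf_le hbdd x)
    · have : u₁ x / u₂ x / (1 + ρ) ≤ ⨅ x, u₁ x / u₂ x := by
        refine le_ciInf fun x' => ?_
        rw [div_div, div_le_div_iff₀ (by have := hu₂.pos x; positivity) (hu₂.pos x')]
        linarith [h x x']
      rw [div_div, div_le_iff₀ (by have := hu₂.pos x; positivity)] at this
      linarith
  have key : ∀ w : X → ℝ, Integrable w μ → (∀ x, 0 ≤ w x) →
      ∀ y : Y, Integrable (fun x => k (x, y) * w x) μ →
      c * ((∫ x, w x ∂μ) / (∫ x, u₂ x ∂μ)) * (∫ x, k (x, y) * u₂ x ∂μ) ≤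
        ∫ x, k (x, y) * w x ∂μ := by
    intro w hw hw0 y hkw
    have hU := hu₂.integral_pos μ
    have h1 : l * ∫ x, w x ∂μ ≤ ∫ x, k (x, y) * w x ∂μ := by
      rw [← integral_const_mul]
      exact integral_mono (hw.const_mul _) hkw
        fun x => mul_le_mul_of_nonneg_right (hlk _) (hw0 x)
    have h2 : ∫ x, k (x, y) * u₂ x ∂μ ≤ L * ∫ x, u₂ x ∂μ := by
      rw [← integral_const_mul]
      exact integral_mono (((hk.left y).mul hu₂).integrable μ) ((hu₂.integrable μ).const_mul _)
        fun x => mul_le_mul_of_nonneg_right (hkL _) (hu₂.pos x).le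
    have hW : 0 ≤ ∫ x, w x ∂μ := integral_nonneg hw0
    calc c * ((∫ x, w x ∂μ) / (∫ x, u₂ x ∂μ)) * (∫ x, k (x, y) * u₂ x ∂μ)
        ≤ c * ((∫ x, w x ∂μ) / (∫ x, u₂ x ∂μ)) * (L * ∫ x, u₂ x ∂μ) := by gcongr
      _ = l * ∫ x, w x ∂μ := by rw [hc]; field_simp
      _ ≤ _ := h1
  have hi1 := fun y => ((hk.left y).mul hu₁).integrable μ
  have hi2 := fun y => ((hk.left y).mul hu₂).integrable μ
  have hj1 := hu₁.integrable μ
  have hj2 := hu₂.integrable μ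
  set A₁ : Y → ℝ := fun y => ∫ x, k (x, y) * u₁ x ∂μ with hA₁
  set A₂ : Y → ℝ := fun y => ∫ x, k (x, y) * u₂ x ∂μ with hA₂
  have hA₂0 : ∀ y, 0 < A₂ y := (isPosBounded_integral_mul hk hu₂).pos
  set s := (∫ x, u₁ x ∂μ) / ∫ x, u₂ x ∂μ with hs
  have hU := hu₂.integral_pos μ
  have hsub : ∀ (a b : ℝ) (y : Y), (fun x => k (x, y) * (a * u₁ x + b * u₂ x)) =
      fun x => a * (k (x, y) * u₁ x) + b * (k (x, y) * u₂ x) := by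
    intro a b y; ext x; ring
  -- Applied to the nonnegative gaps `u₁ - α u₂` and `(1 + ρ) α u₂ - u₁`, this moves both bounds on
  -- `A₁ / A₂` inwards by a share `c` of their distance to the average `s`.
  have key' : ∀ (a b : ℝ), (∀ x, 0 ≤ a * u₁ x + b * u₂ x) → ∀ y,
      c * (a * s + b) * A₂ y ≤ a * A₁ y + b * A₂ y := by
    intro a b hab y
    have hint : ∀ y, Integrable (fun x => k (x, y) * (a * u₁ x + b * u₂ x)) μ := fun y => by
      rw [hsub]; exact ((hi1 y).const_mul a).add ((hi2 y).const_mul b)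
    have := key (fun x => a * u₁ x + b * u₂ x) ((hj1.const_mul a).add (hj2.const_mul b)) hab
      y (hint y)
    rw [hsub, integral_add ((hi1 y).const_mul a) ((hi2 y).const_mul b),
      integral_add (hj1.const_mul a) (hj2.const_mul b), integral_const_mul, integral_const_mul,
      integral_const_mul, integral_const_mul, add_div, mul_div_assoc, mul_div_assoc,
      div_self hU.ne', mul_one] at this
    exact this
  have low := key' 1 (-α) (fun x => by linarith [hα x]) y'
  have up := key' (-1) ((1 + ρ) * α) (fun x => by linarith [hβ x]) y
  have hs0 : 0 ≤ s - α := by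
    rw [hs, sub_nonneg, le_div_iff₀ hU, ← integral_const_mul]
    exact integral_mono (hj2.const_mul _) hj1 hα
  change A₁ y * A₂ y' ≤ (1 + (1 - c) * ρ) * (A₁ y' * A₂ y)
  have low' : (α + c * (s - α)) * A₂ y' ≤ A₁ y' := by linarith
  have up' : A₁ y ≤ (α + c * (s - α) + (1 - c) * ρ * α) * A₂ y := by linarith
  have hq : 0 ≤ (1 - c) * ρ := mul_nonneg (sub_nonneg.2 hc1) hρ
  have h0 : 0 ≤ c * (s - α) := mul_nonneg hc0 hs0
  calc A₁ y * A₂ y' ≤ (α + c * (s - α) + (1 - c) * ρ * α) * A₂ y * A₂ y' := by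
        gcongr; exact (hA₂0 y').le
    _ ≤ ((1 + (1 - c) * ρ) * (α + c * (s - α))) * A₂ y * A₂ y' := by
        have := hA₂0 y
        have := hA₂0 y'
        gcongr
        nlinarith [mul_nonneg hq h0]
    _ = (1 + (1 - c) * ρ) * ((α + c * (s - α)) * A₂ y' * A₂ y) := by ring
    _ ≤ (1 + (1 - c) * ρ) * (A₁ y' * A₂ y) := by
        have := hA₂0 y
        gcongr

theorem sinkhornStep_contraction (hk : IsPosBounded k) {l L : ℝ} (hl : 0 < l)
    (hlk : ∀ z, l ≤ k z) (hkL : ∀ z, k z ≤ L) {u₁ u₂ : X → ℝ} (hu₁ : IsPosBounded u₁)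
    (hu₂ : IsPosBounded u₂) {ρ : ℝ} (hρ : 0 ≤ ρ)
    (h : ∀ x x', u₁ x * u₂ x' ≤ (1 + ρ) * (u₁ x' * u₂ x)) (y y' : Y) :
    sinkhornStep μ k u₁ y * sinkhornStep μ k u₂ y' ≤
      (1 + (1 - l / L) * ρ) * (sinkhornStep μ k u₁ y' * sinkhornStep μ k u₂ y) := by
  -- Taking reciprocals exchanges the roles of `y` and `y'` and keeps the oscillation constant.
  have H := integral_mul_contraction (μ := μ) hk hl hlk hkL hu₁ hu₂ hρ h y' y
  have p1 := (isPosBounded_integral_mul (μ := μ) hk hu₁).pos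
  have p2 := (isPosBounded_integral_mul (μ := μ) hk hu₂).pos
  simp only [sinkhornStep, ← mul_inv]
  rw [← div_eq_mul_inv, le_div_iff₀ (mul_pos (p1 y') (p2 y)),
    inv_mul_le_iff₀ (mul_pos (p1 y) (p2 y'))]
  linarith

theorem tendsto_sinkhornStep (hk : IsPosBounded k) {f : ℕ → X → ℝ} {g : X → ℝ} {a b : ℝ}
    (hf : ∀ n, IsPosBounded (f n)) (ha : 0 < a) (hab : ∀ n x, a ≤ f n x ∧ f n x ≤ b)
    (hlim : ∀ x, Filter.Tendsto (fun n => f n x) Filter.atTop (nhds (g x))) (y : Y) :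
    Filter.Tendsto (fun n => sinkhornStep μ k (f n) y) Filter.atTop
      (nhds (sinkhornStep μ k g y)) := by
  have hg : IsPosBounded g :=
    ⟨measurable_of_tendsto_metrizable (fun n => (hf n).measurable) (tendsto_pi_nhds.2 hlim),
      a, b, ha, fun x => ⟨ge_of_tendsto' (hlim x) fun n => (hab n x).1,
        le_of_tendsto' (hlim x) fun n => (hab n x).2⟩⟩
  refine Filter.Tendsto.inv₀ ?_ ((isPosBounded_integral_mul hk hg).pos y).ne'
  refine tendsto_integral_of_dominated_convergence (fun x => k (x, y) * b)
    (fun n => ((hk.left y).mul (hf n)).measurable.aestronglyMeasurable)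
    (((hk.left y).integrable μ).mul_const b) (fun n => ae_of_all _ fun x => ?_)
    (ae_of_all _ fun x => (hlim x).const_mul _)
  rw [Real.norm_of_nonneg (((hk.left y).mul (hf n)).pos x).le]
  exact mul_le_mul_of_nonneg_left (hab n x).2 (hk.pos _).le

end Sinkhorn

/-- The iterates of the Sinkhorn map, normalised at a point, converge pointwise to a function
fixed by the Sinkhorn map up to a multiplicative constant. -/
theorem exists_sinkhorn_eigenfunction {X Y : Type*} [MeasurableSpace X] [MeasurableSpace Y]
    (μ : Measure X) (ν : Measure Y) [IsProbabilityMeasure μ] [IsProbabilityMeasure ν]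
    {k : X × Y → ℝ} (hk : IsPosBounded k) :
    ∃ (u : X → ℝ) (c : ℝ), IsPosBounded u ∧ 0 < c ∧
      ∀ x, sinkhornStep ν (fun z => k z.swap) (sinkhornStep μ k u) x = c * u x := by
  obtain ⟨l, L, hl, hkb⟩ := hk.exists_bounds
  have hlk := fun z => (hkb z).1
  have hkL := fun z => (hkb z).2
  have hk' := hk.swap
  have : Nonempty X := nonempty_of_isProbabilityMeasure μ
  have : Nonempty Y := nonempty_of_isProbabilityMeasure ν
  obtain ⟨x₀⟩ := ‹Nonempty X›
  obtain ⟨y₀⟩ := ‹Nonempty Y›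
  have hlL : l ≤ L := (hlk (x₀, y₀)).trans (hkL _)
  have hL : 0 < L := hl.trans_le hlL
  set T : (X → ℝ) → X → ℝ := fun u => sinkhornStep ν (fun z => k z.swap) (sinkhornStep μ k u)
    with hT
  have hTpos : ∀ {u}, IsPosBounded u → IsPosBounded (T u) :=
    fun hu => hk'.sinkhornStep (hk.sinkhornStep hu)
  have hTle : ∀ {u}, IsPosBounded u → ∀ x x', T u x ≤ L / l * T u x' := fun hu x x' =>
    sinkhornStep_le_mul hk' hl (fun z => hlk z.swap) (fun z => hkL z.swap)
      (hk.sinkhornStep hu) x x'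
  have hTmul : ∀ (c : ℝ) (u : X → ℝ), T (fun x => c * u x) = fun x => c * T u x := by
    intro c u
    simp only [hT, sinkhornStep_const_mul, inv_inv]
  set B := L / l with hB
  have hB1 : 1 ≤ B := (one_le_div hl).2 hlL
  set q := 1 - l / L with hq
  have hq0 : 0 ≤ q := sub_nonneg.2 ((div_le_one hL).2 hlL)
  have hq1 : q < 1 := sub_lt_self _ (div_pos hl hL)
  have hTcontr : ∀ {u₁ u₂}, IsPosBounded u₁ → IsPosBounded u₂ → ∀ {ρ : ℝ}, 0 ≤ ρ →
      (∀ x x', u₁ x * u₂ x' ≤ (1 + ρ) * (u₁ x' * u₂ x)) →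
      ∀ x x', T u₁ x * T u₂ x' ≤ (1 + q * (q * ρ)) * (T u₁ x' * T u₂ x) := by
    intro u₁ u₂ h1 h2 ρ hρ h
    exact sinkhornStep_contraction hk' hl (fun z => hlk z.swap) (fun z => hkL z.swap)
      (hk.sinkhornStep h1) (hk.sinkhornStep h2) (mul_nonneg hq0 hρ)
      (sinkhornStep_contraction hk hl hlk hkL h1 h2 hρ h)
  set U : ℕ → X → ℝ := fun n => T^[n] fun _ => 1 with hU
  have hUs : ∀ n, U (n + 1) = T (U n) := fun n => Function.iterate_succ_apply' _ _ _
  have hUpos : ∀ n, IsPosBounded (U n) := by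
    intro n
    induction n with
    | zero => exact isPosBounded_const one_pos
    | succ n ih => rw [hUs]; exact hTpos ih
  have hUle : ∀ n x x', U n x ≤ B * U n x' := by
    intro n x x'
    cases n with
    | zero => simpa [hU] using hB1
    | succ n => rw [hUs]; exact hTle (hUpos n) x x'
  -- Consecutive iterates become projectively close at a geometric rate, with `q * q` from the two
  -- half steps. Since `U 0` is constant, the initial oscillation is that of `U 1`, at most `B`.
  have hρ : ∀ n x x', U (n + 1) x * U n x' ≤
      (1 + (q * q) ^ n * (B - 1)) * (U (n + 1) x' * U n x) := by
    intro n
    induction n with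
    | zero =>
      intro x x'
      have := hUle 1 x x'
      simpa [hU] using this
    | succ n ih =>
      intro x x'
      have := hTcontr (hUpos (n + 1)) (hUpos n)
        (mul_nonneg (pow_nonneg (mul_nonneg hq0 hq0) n) (sub_nonneg.2 hB1)) ih x x'
      rw [← hUs, ← hUs] at this
      convert this using 2
      ring
  set V : ℕ → X → ℝ := fun n x => (U n x₀)⁻¹ * U n x with hV
  have hVpos : ∀ n, IsPosBounded (V n) := fun n =>
    (isPosBounded_const (inv_pos.2 ((hUpos n).pos x₀))).mul (hUpos n)
  have hVle : ∀ n x, V n x ≤ B := by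
    intro n x
    rw [hV]
    simp only
    rw [inv_mul_le_iff₀ ((hUpos n).pos x₀), mul_comm]
    exact hUle n x x₀
  have hVge : ∀ n x, B⁻¹ ≤ V n x := by
    intro n x
    have h0 := (hUpos n).pos x₀
    rw [hV]
    simp only
    rw [inv_mul_eq_div, le_div_iff₀ h0, inv_mul_le_iff₀ (by positivity)]
    exact hUle n x₀ x
  have hr0 : 0 ≤ q * q := mul_nonneg hq0 hq0
  have hr1 : q * q < 1 := mul_lt_one_of_nonneg_of_lt_one_left hq0 hq1 hq1.le
  have hstep : ∀ x n, dist (V n x) (V (n + 1) x) ≤ B * (B - 1) * (q * q) ^ n := by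
    intro x n
    -- The normalisation at `x₀` turns the projective estimate, with `x₀` as one of the two points,
    -- into a pointwise one.
    have e1 : V (n + 1) x ≤ (1 + (q * q) ^ n * (B - 1)) * V n x := by
      have := hρ n x x₀
      have p0 := (hUpos n).pos x₀
      have p1 := (hUpos (n + 1)).pos x₀
      simp only [hV]
      rw [inv_mul_le_iff₀ p1, ← mul_le_mul_iff_left₀ p0]
      calc _ ≤ _ := this
        _ = _ := by field_simp
    have e2 : V n x ≤ (1 + (q * q) ^ n * (B - 1)) * V (n + 1) x := by
      have := hρ n x₀ x
      have p0 := (hUpos n).pos x₀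
      have p1 := (hUpos (n + 1)).pos x₀
      simp only [hV]
      rw [inv_mul_le_iff₀ p0, ← mul_le_mul_iff_left₀ p1]
      calc _ = _ := mul_comm _ _
        _ ≤ _ := this
        _ = _ := by field_simp
    have hε : 0 ≤ (q * q) ^ n * (B - 1) := mul_nonneg (pow_nonneg hr0 n) (sub_nonneg.2 hB1)
    have e3 := mul_le_mul_of_nonneg_left (hVle n x) hε
    have e4 := mul_le_mul_of_nonneg_left (hVle (n + 1) x) hε
    rw [Real.dist_eq, abs_le]
    constructor <;> linarith
  have hlim : ∀ x, ∃ w, Filter.Tendsto (fun n => V n x) Filter.atTop (nhds w) := fun x =>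
    cauchySeq_tendsto_of_complete (cauchySeq_of_le_geometric _ _ hr1 (hstep x))
  choose u hu using hlim
  have hBinv : 0 < B⁻¹ := by positivity
  have hupos : IsPosBounded u :=
    ⟨measurable_of_tendsto_metrizable (fun n => (hVpos n).measurable) (tendsto_pi_nhds.2 hu),
      B⁻¹, B, hBinv, fun x => ⟨ge_of_tendsto' (hu x) fun n => hVge n x,
        le_of_tendsto' (hu x) fun n => hVle n x⟩⟩
  have hTlim : ∀ x, Filter.Tendsto (fun n => T (V n) x) Filter.atTop (nhds (T u x)) := by
    -- Bounds uniform in `n`, needed for dominated convergence in the second half step.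
    obtain ⟨a, b, ha, hab⟩ : ∃ a b : ℝ, 0 < a ∧ ∀ n y,
        a ≤ sinkhornStep μ k (V n) y ∧ sinkhornStep μ k (V n) y ≤ b := by
      refine ⟨(L * B)⁻¹, (l * B⁻¹)⁻¹, by positivity, fun n y => ⟨?_, ?_⟩⟩
      · refine inv_anti₀ ((isPosBounded_integral_mul hk (hVpos n)).pos y) ?_
        simpa using integral_mono (((hk.left y).mul (hVpos n)).integrable μ)
          (integrable_const (L * B)) fun x =>
            mul_le_mul (hkL _) (hVle n x) ((hVpos n).pos x).le hL.le
      · refine inv_anti₀ (by positivity) ?_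
        simpa using integral_mono (integrable_const (l * B⁻¹))
          (((hk.left y).mul (hVpos n)).integrable μ) fun x =>
            mul_le_mul (hlk _) (hVge n x) hBinv.le (hk.pos _).le
    exact tendsto_sinkhornStep hk' (fun n => hk.sinkhornStep (hVpos n)) ha hab
      (tendsto_sinkhornStep hk hVpos hBinv (fun n x => ⟨hVge n x, hVle n x⟩) hu)
  refine ⟨u, T u x₀, hupos, (hTpos hupos).pos x₀, fun x => ?_⟩
  refine tendsto_nhds_unique (hTlim x) ?_
  -- `T` is homogeneous of degree one, so renormalising at `x₀` only extracts a scalar factor.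
  have : (fun n => T (V n) x) = fun n => T (V n) x₀ * V (n + 1) x := by
    ext n
    have p1 := (hUpos (n + 1)).pos x₀
    simp only [hV, hTmul, ← hUs]
    field_simp
  rw [this]
  exact (hTlim x₀).mul ((Filter.tendsto_add_atTop_iff_nat 1).2 (hu x))

/-- Solvability of the Schrödinger system for a bounded kernel. -/
theorem exists_schrodinger_system {X Y : Type*} [MeasurableSpace X] [MeasurableSpace Y]
    (μ : Measure X) (ν : Measure Y) [IsProbabilityMeasure μ] [IsProbabilityMeasure ν]
    {k : X × Y → ℝ} (hk : IsPosBounded k) :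
    ∃ (u : X → ℝ) (v : Y → ℝ), IsPosBounded u ∧ IsPosBounded v ∧
      (∀ x, u x * ∫ y, k (x, y) * v y ∂ν = 1) ∧ ∀ y, v y * ∫ x, k (x, y) * u x ∂μ = 1 := by
  obtain ⟨u, c, hu, hc, huc⟩ := exists_sinkhorn_eigenfunction μ ν hk
  set v := sinkhornStep μ k u with hv
  have hvp : IsPosBounded v := hk.sinkhornStep hu
  have h2 : ∀ y, v y * ∫ x, k (x, y) * u x ∂μ = 1 := fun y =>
    inv_mul_cancel₀ ((isPosBounded_integral_mul hk hu).pos y).ne'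
  have h1 : ∀ x, u x * ∫ y, k (x, y) * v y ∂ν = c⁻¹ := by
    intro x
    have h := huc x
    have hpos : 0 < ∫ y, k (x, y) * v y ∂ν :=
      (isPosBounded_integral_mul (k := fun z : Y × X => k z.swap) hk.swap hvp).pos x
    change (∫ y, k (x, y) * v y ∂ν)⁻¹ = c * u x at h
    rw [inv_eq_iff_eq_inv] at h
    rw [h]
    have := hu.pos x
    field_simp
  -- The total mass of the density `u k v`, integrated in the two orders, is `c⁻¹` and 1.
  have hc1 : c⁻¹ = 1 := by
    have hint : Integrable (fun z : X × Y => u z.1 * (k z * v z.2)) (μ.prod ν) :=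
      ((hu.comp measurable_fst).mul (hk.mul (hvp.comp measurable_snd))).integrable _
    have e1 : ∫ z, u z.1 * (k z * v z.2) ∂(μ.prod ν) = c⁻¹ := by
      rw [integral_prod _ hint]
      simp only [integral_const_mul, h1]
      simp
    have e2 : ∫ z, u z.1 * (k z * v z.2) ∂(μ.prod ν) = 1 := by
      rw [integral_prod_symm _ hint]
      have : ∀ x y, u x * (k (x, y) * v y) = v y * (k (x, y) * u x) := fun x y => by ring
      simp only [this, integral_const_mul, h2]
      simp
    rw [← e1, e2]
  exact ⟨u, v, hu, hvp, fun x => (h1 x).trans hc1, h2⟩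

/-! ### Relative entropy of couplings and characterisation of the bridge -/

theorem IsPosBounded.integral_log_le {Z : Type*} [MeasurableSpace Z] {w : Z → ℝ}
    (hw : IsPosBounded w) (μ : Measure Z) [IsProbabilityMeasure μ] :
    ∫ z, Real.log (w z) ∂μ ≤ Real.log (∫ z, w z ∂μ) := by
  have hexplog : ∀ z, Real.exp (Real.log (w z)) = w z := fun z => Real.exp_log (hw.pos z)
  rw [Real.le_log_iff_exp_le (hw.integral_pos μ)]
  simpa only [hexplog] using convexOn_exp.map_integral_le (μ := μ)
    (f := fun z => Real.log (w z)) Real.continuous_exp.continuousOn isClosed_univ (by simp)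
    (hw.integrable_log μ) (by simpa only [Function.comp_def, hexplog] using hw.integrable μ)

theorem IsCoupling.isProbabilityMeasure {X Y : Type*} [MeasurableSpace X] [MeasurableSpace Y]
    {μ₀ : Measure X} {μ₁ : Measure Y} {H : Measure (X × Y)} [IsProbabilityMeasure μ₀]
    (h : IsCoupling H μ₀ μ₁) : IsProbabilityMeasure H :=
  ⟨by rw [← Measure.fst_univ, h.fst_eq, measure_univ]⟩

theorem IsCoupling.integrable_add {X Y : Type*} [MeasurableSpace X] [MeasurableSpace Y]
    {μ₀ : Measure X} {μ₁ : Measure Y} {H : Measure (X × Y)} (h : IsCoupling H μ₀ μ₁)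
    {φ : X → ℝ} {ψ : Y → ℝ} (hφ : Integrable φ μ₀) (hψ : Integrable ψ μ₁) :
    Integrable (fun z : X × Y => φ z.1 + ψ z.2) H := by
  rw [← h.fst_eq] at hφ
  rw [← h.snd_eq] at hψ
  exact (hφ.comp_measurable measurable_fst).add (hψ.comp_measurable measurable_snd)

theorem IsCoupling.integral_add {X Y : Type*} [MeasurableSpace X] [MeasurableSpace Y]
    {μ₀ : Measure X} {μ₁ : Measure Y} {H : Measure (X × Y)} (h : IsCoupling H μ₀ μ₁)
    {φ : X → ℝ} {ψ : Y → ℝ} (hφ : Integrable φ μ₀) (hψ : Integrable ψ μ₁) :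
    ∫ z, (φ z.1 + ψ z.2) ∂H = ∫ x, φ x ∂μ₀ + ∫ y, ψ y ∂μ₁ := by
  rw [← h.fst_eq] at hφ ⊢
  rw [← h.snd_eq] at hψ ⊢
  rw [Measure.fst, Measure.snd,
    integral_map measurable_fst.aemeasurable hφ.aestronglyMeasurable,
    integral_map measurable_snd.aemeasurable hψ.aestronglyMeasurable]
  exact MeasureTheory.integral_add (hφ.comp_measurable measurable_fst)
    (hψ.comp_measurable measurable_snd)

section Bridge

variable {X Y : Type*} [MeasurableSpace X] [MeasurableSpace Y]
  {μ₀ : Measure X} {μ₁ : Measure Y} [IsProbabilityMeasure μ₀]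
  {R : Measure (X × Y)} [IsProbabilityMeasure R] {φ : X → ℝ} {ψ : Y → ℝ}

/-- The Pythagorean identity for the relative entropy of couplings. -/
theorem IsCoupling.klDiv_tilted {H : Measure (X × Y)} (h : IsCoupling H μ₀ μ₁)
    (hφ : Integrable φ μ₀) (hψ : Integrable ψ μ₁)
    (hexp : Integrable (fun z : X × Y => Real.exp (φ z.1 + ψ z.2)) R)
    (hone : ∫ z, Real.exp (φ z.1 + ψ z.2) ∂(R) = 1) (hH : klDiv H R ≠ ∞) :
    klDiv H (R.tilted fun z => φ z.1 + ψ z.2) ≠ ∞ ∧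
      (klDiv H R).toReal = (klDiv H (R.tilted fun z => φ z.1 + ψ z.2)).toReal +
        (∫ x, φ x ∂μ₀ + ∫ y, ψ y ∂μ₁) := by
  have := h.isProbabilityMeasure
  have := isProbabilityMeasure_tilted hexp
  obtain ⟨hac, hint⟩ := klDiv_ne_top_iff.1 hH
  have hac' := hac.trans (absolutelyContinuous_tilted hexp)
  have hf := h.integrable_add hφ hψ
  refine ⟨klDiv_ne_top hac' (integrable_llr_tilted_right hac hf hint hexp), ?_⟩
  rw [toReal_klDiv_of_measure_eq hac (by simp), toReal_klDiv_of_measure_eq hac' (by simp),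
    integral_llr_tilted_right hac hf hexp hint, hone, h.integral_add hφ hψ]
  simp

/-- The log-density is `φ ⊕ ψ` with zero normalising constant, so its integral depends on the
marginals only. Besides minimality, this shows that the integrals of the potentials have a
nonnegative sum. -/
theorem klDiv_tilted_self (hφ : Integrable φ μ₀) (hψ : Integrable ψ μ₁)
    (hexp : Integrable (fun z : X × Y => Real.exp (φ z.1 + ψ z.2)) R)
    (hone : ∫ z, Real.exp (φ z.1 + ψ z.2) ∂(R) = 1)
    (hπ : IsCoupling (R.tilted fun z => φ z.1 + ψ z.2) μ₀ μ₁) :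
    klDiv (R.tilted fun z => φ z.1 + ψ z.2) R ≠ ∞ ∧
      (klDiv (R.tilted fun z => φ z.1 + ψ z.2) R).toReal = ∫ x, φ x ∂μ₀ + ∫ y, ψ y ∂μ₁ := by
  have := isProbabilityMeasure_tilted hexp
  have hfin : klDiv (R.tilted fun z => φ z.1 + ψ z.2) R ≠ ∞ := by
    refine klDiv_ne_top (tilted_absolutelyContinuous _ _) ?_
    refine (hπ.integrable_add hφ hψ).congr ?_
    filter_upwards [(tilted_absolutelyContinuous R fun z => φ z.1 + ψ z.2).ae_le
      (log_rnDeriv_tilted_left_self hexp)] with z hz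
    rw [llr, hz, hone, Real.log_one, sub_zero]
  refine ⟨hfin, ?_⟩
  rw [(hπ.klDiv_tilted hφ hψ hexp hone hfin).2, klDiv_self]
  simp

/-- A coupling whose density with respect to the reference measure is a product of potentials
is the unique static Schrödinger bridge. -/
theorem isStaticSchrodingerBridge_iff_eq_tilted (hφ : Integrable φ μ₀) (hψ : Integrable ψ μ₁)
    (hexp : Integrable (fun z : X × Y => Real.exp (φ z.1 + ψ z.2)) R)
    (hone : ∫ z, Real.exp (φ z.1 + ψ z.2) ∂(R) = 1)
    (hπ : IsCoupling (R.tilted fun z => φ z.1 + ψ z.2) μ₀ μ₁) (H : Measure (X × Y)) :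
    IsStaticSchrodingerBridge μ₀ μ₁ R H ↔ H = R.tilted fun z => φ z.1 + ψ z.2 := by
  obtain ⟨hfin, hval⟩ := klDiv_tilted_self hφ hψ hexp hone hπ
  constructor
  · intro hH
    have := hH.isCoupling.isProbabilityMeasure
    have := hπ.isProbabilityMeasure
    have hle := hH.klDiv_le _ hπ
    obtain ⟨h1, h2⟩ := hH.isCoupling.klDiv_tilted hφ hψ hexp hone (ne_top_of_le_ne_top hfin hle)
    have h3 := ENNReal.toReal_mono hfin hle
    -- By the Pythagorean identity, the entropy of `H` exceeds the minimum exactly by its divergence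
    -- from the tilted measure.
    have h4 : (klDiv H (R.tilted fun z => φ z.1 + ψ z.2)).toReal = 0 :=
      le_antisymm (by linarith) ENNReal.toReal_nonneg
    exact klDiv_eq_zero_iff.1 (((ENNReal.toReal_eq_zero_iff _).1 h4).resolve_right h1)
  · rintro rfl
    refine ⟨hπ, fun H hH => ?_⟩
    by_cases hHR : klDiv H R = ∞
    · rw [hHR]; exact le_top
    · rw [← ENNReal.toReal_le_toReal hfin hHR, hval, (hH.klDiv_tilted hφ hψ hexp hone hHR).2]
      exact le_add_of_nonneg_left ENNReal.toReal_nonneg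

end Bridge

/-! ### Schrödinger potentials and their upper bound -/

theorem isCoupling_withDensity {X Y : Type*} [MeasurableSpace X] [MeasurableSpace Y]
    (μ₀ : Measure X) (μ₁ : Measure Y) [IsProbabilityMeasure μ₀] [IsProbabilityMeasure μ₁]
    {p : X × Y → ℝ} (hp : IsPosBounded p) (h₀ : ∀ x, ∫ y, p (x, y) ∂μ₁ = 1)
    (h₁ : ∀ y, ∫ x, p (x, y) ∂μ₀ = 1) :
    IsCoupling ((μ₀.prod μ₁).withDensity fun z => ENNReal.ofReal (p z)) μ₀ μ₁ := by
  have hm : Measurable fun z => ENNReal.ofReal (p z) := hp.measurable.ennreal_ofReal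
  have h₀' : ∀ x, ∫⁻ y, ENNReal.ofReal (p (x, y)) ∂μ₁ = 1 := fun x => by
    rw [← ofReal_integral_eq_lintegral_ofReal ((hp.right x).integrable μ₁)
      (ae_of_all _ fun y => (hp.pos _).le), h₀, ENNReal.ofReal_one]
  have h₁' : ∀ y, ∫⁻ x, ENNReal.ofReal (p (x, y)) ∂μ₀ = 1 := fun y => by
    rw [← ofReal_integral_eq_lintegral_ofReal ((hp.left y).integrable μ₀)
      (ae_of_all _ fun x => (hp.pos _).le), h₁, ENNReal.ofReal_one]
  constructor
  · ext s hs
    rw [Measure.fst_apply hs, withDensity_apply _ (measurable_fst hs), ← Set.prod_univ,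
      setLIntegral_prod _ hm.aemeasurable]
    simp [h₀']
  · ext s hs
    rw [Measure.snd_apply hs, withDensity_apply _ (measurable_snd hs), ← Set.univ_prod,
      setLIntegral_prod_symm _ hm.aemeasurable]
    simp [h₁']

/-- Schrödinger potentials for a bounded cost `κ ≤ M`: the Schrödinger bridge has the density
`exp (φ x + ψ y - κ (x, y))`, and `φ x + ψ y ≤ 2 * M`. -/
theorem exists_schrodinger_potentials {X Y : Type*} [MeasurableSpace X] [MeasurableSpace Y]
    (μ₀ : Measure X) (μ₁ : Measure Y) [IsProbabilityMeasure μ₀] [IsProbabilityMeasure μ₁]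
    {κ : X × Y → ℝ} (hκ : Measurable κ) {K M : ℝ} (hK : ∀ z, -K ≤ κ z) (hM : ∀ z, κ z ≤ M)
    [hR : IsProbabilityMeasure (costMeasure μ₀ μ₁ κ)] :
    ∃ (φ : X → ℝ) (ψ : Y → ℝ) (C : ℝ), Measurable φ ∧ Measurable ψ ∧ (∀ x, |φ x| ≤ C) ∧
      (∀ y, |ψ y| ≤ C) ∧ (∀ x y, φ x + ψ y ≤ 2 * M) ∧
      IsCoupling (costMeasure μ₀ μ₁ fun z => κ z - (φ z.1 + ψ z.2)) μ₀ μ₁ ∧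
      ∀ H, IsStaticSchrodingerBridge μ₀ μ₁ (costMeasure μ₀ μ₁ κ) H ↔
        H = costMeasure μ₀ μ₁ fun z => κ z - (φ z.1 + ψ z.2) := by
  set R := costMeasure μ₀ μ₁ κ with hRdef
  have hk : IsPosBounded fun z => Real.exp (-κ z) :=
    ⟨Real.measurable_exp.comp hκ.neg, Real.exp (-M), Real.exp K, Real.exp_pos _, fun z =>
      ⟨Real.exp_le_exp.2 (neg_le_neg (hM z)), Real.exp_le_exp.2 (neg_le.1 (hK z))⟩⟩
  obtain ⟨u, v, hu, hv, h₀, h₁⟩ := exists_schrodinger_system μ₀ μ₁ hk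
  obtain ⟨Cu, hCu⟩ := hu.abs_log_le
  obtain ⟨Cv, hCv⟩ := hv.abs_log_le
  have hφ := hu.integrable_log μ₀
  have hψ := hv.integrable_log μ₁
  have hexp_eq : ∀ z : X × Y, Real.exp (Real.log (u z.1) + Real.log (v z.2)) = u z.1 * v z.2 :=
    fun z => by rw [Real.exp_add, Real.exp_log (hu.pos _), Real.exp_log (hv.pos _)]
  have huv : IsPosBounded fun z : X × Y => u z.1 * v z.2 :=
    (hu.comp measurable_fst).mul (hv.comp measurable_snd)
  have hexp : Integrable (fun z : X × Y => Real.exp (Real.log (u z.1) + Real.log (v z.2))) R := by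
    simp only [hexp_eq]
    exact huv.integrable R
  have hp : IsPosBounded fun z : X × Y => Real.exp (-κ z) * (u z.1 * v z.2) := hk.mul huv
  have hpe : ∀ z : X × Y, Real.exp (-(κ z - (Real.log (u z.1) + Real.log (v z.2)))) =
      Real.exp (-κ z) * (u z.1 * v z.2) := fun z => by
    rw [← hexp_eq, ← Real.exp_add]; ring_nf
  have hmarg₀ : ∀ x, ∫ y, Real.exp (-κ (x, y)) * (u x * v y) ∂μ₁ = 1 := fun x => by
    have : ∀ y, Real.exp (-κ (x, y)) * (u x * v y) = u x * (Real.exp (-κ (x, y)) * v y) :=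
      fun y => by ring
    simp only [this, integral_const_mul, h₀]
  have hmarg₁ : ∀ y, ∫ x, Real.exp (-κ (x, y)) * (u x * v y) ∂μ₀ = 1 := fun y => by
    have : ∀ x, Real.exp (-κ (x, y)) * (u x * v y) = v y * (Real.exp (-κ (x, y)) * u x) :=
      fun x => by ring
    simp only [this, integral_const_mul, h₁]
  have hone : ∫ z, Real.exp (Real.log (u z.1) + Real.log (v z.2)) ∂(R) = 1 := by
    simp only [hexp_eq]
    rw [hRdef, costMeasure, integral_withDensity_eq_integral_toReal_smul₀
      hk.measurable.ennreal_ofReal.aemeasurable (ae_of_all _ fun z => ENNReal.ofReal_lt_top)]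
    simp only [ENNReal.toReal_ofReal (Real.exp_pos _).le, smul_eq_mul]
    rw [integral_prod _ (hp.integrable _)]
    simp [hmarg₀]
  have htilt : R.tilted (fun z => Real.log (u z.1) + Real.log (v z.2)) =
      costMeasure μ₀ μ₁ fun z => κ z - (Real.log (u z.1) + Real.log (v z.2)) := by
    rw [Measure.tilted, hone, hRdef, costMeasure, costMeasure,
      ← withDensity_mul _ hk.measurable.ennreal_ofReal]
    · congr 1
      ext z
      rw [Pi.mul_apply, div_one, hexp_eq, hpe, ENNReal.ofReal_mul (Real.exp_pos _).le]
    · simp only [hexp_eq, div_one]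
      exact huv.measurable.ennreal_ofReal
  have hcoup : IsCoupling (costMeasure μ₀ μ₁ fun z =>
      κ z - (Real.log (u z.1) + Real.log (v z.2))) μ₀ μ₁ := by
    simp only [costMeasure, hpe]
    exact isCoupling_withDensity μ₀ μ₁ hp hmarg₀ hmarg₁
  refine ⟨fun x => Real.log (u x), fun y => Real.log (v y), max Cu Cv,
    Real.measurable_log.comp hu.measurable, Real.measurable_log.comp hv.measurable,
    fun x => (hCu x).trans (le_max_left _ _), fun y => (hCv y).trans (le_max_right _ _),
    fun x y => ?_, hcoup, ?_⟩
  -- The sum of integrals is the entropy of the bridge relative to `R`. Only the sum of the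
  -- potentials can be bounded this way, as each one is determined up to a constant.
  · have hE : 0 ≤ ∫ x, Real.log (u x) ∂μ₀ + ∫ y, Real.log (v y) ∂μ₁ := by
      rw [← (klDiv_tilted_self hφ hψ hexp hone (htilt ▸ hcoup)).2]
      exact ENNReal.toReal_nonneg
    -- The marginal equation at `x` with the kernel replaced by its lower bound `exp (-M)`.
    have hx : Real.log (u x) + Real.log (∫ y, v y ∂μ₁) ≤ M := by
      rw [← Real.log_mul (hu.pos x).ne' (hv.integral_pos μ₁).ne',
        Real.log_le_iff_le_exp (mul_pos (hu.pos x) (hv.integral_pos μ₁))]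
      have h : Real.exp (-M) * ∫ y, v y ∂μ₁ ≤ ∫ y, Real.exp (-κ (x, y)) * v y ∂μ₁ := by
        rw [← integral_const_mul]
        exact integral_mono ((hv.integrable μ₁).const_mul _)
          (((hk.right x).mul hv).integrable μ₁) fun y =>
            mul_le_mul_of_nonneg_right (Real.exp_le_exp.2 (neg_le_neg (hM _))) (hv.pos y).le
      have h' := mul_le_mul_of_nonneg_left h (hu.pos x).le
      rw [h₀, Real.exp_neg] at h'
      rw [← div_le_one (Real.exp_pos M)]
      calc _ = _ := by ring
        _ ≤ _ := h'
    have hy : Real.log (v y) + Real.log (∫ x, u x ∂μ₀) ≤ M := by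
      rw [← Real.log_mul (hv.pos y).ne' (hu.integral_pos μ₀).ne',
        Real.log_le_iff_le_exp (mul_pos (hv.pos y) (hu.integral_pos μ₀))]
      have h : Real.exp (-M) * ∫ x, u x ∂μ₀ ≤ ∫ x, Real.exp (-κ (x, y)) * u x ∂μ₀ := by
        rw [← integral_const_mul]
        exact integral_mono ((hu.integrable μ₀).const_mul _)
          (((hk.left y).mul hu).integrable μ₀) fun x =>
            mul_le_mul_of_nonneg_right (Real.exp_le_exp.2 (neg_le_neg (hM _))) (hu.pos x).le
      have h' := mul_le_mul_of_nonneg_left h (hv.pos y).le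
      rw [h₁, Real.exp_neg] at h'
      rw [← div_le_one (Real.exp_pos M)]
      calc _ = _ := by ring
        _ ≤ _ := h'
    linarith [hu.integral_log_le μ₀, hv.integral_log_le μ₁]
  · intro H
    rw [isStaticSchrodingerBridge_iff_eq_tilted hφ hψ hexp hone (htilt ▸ hcoup), htilt]

/-! ### Hellinger stability -/

section Stability

variable {X Y : Type*} [MeasurableSpace X] [MeasurableSpace Y]

theorem ae_le_posPartSupNorm {Z : Type*} [MeasurableSpace Z] {σ : Measure Z} {κ : Z → ℝ}
    (hκ : MemLp κ ∞ σ) : ∀ᵐ z ∂σ, κ z ≤ posPartSupNorm σ κ := by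
  have h : MemLp (fun z => max (κ z) 0) ∞ σ := hκ.pos_part
  have hfin : eLpNormEssSup (fun z => max (κ z) 0) σ ≠ ∞ := by
    simpa only [eLpNorm_exponent_top] using h.2.ne
  filter_upwards [ae_le_eLpNormEssSup (f := fun z => max (κ z) 0) (μ := σ)] with z hz
  have h1 := ENNReal.toReal_mono hfin hz
  rw [toReal_enorm] at h1
  rw [posPartSupNorm, eLpNorm_exponent_top]
  exact (le_max_left _ _).trans ((le_abs_self _).trans h1)

/-- Truncating a measurable version turns almost everywhere bounds into bounds at every point, as
the Sinkhorn argument requires. Since `-K ≤ 0 ≤ M`, the two truncations are compatible. -/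
theorem exists_bounded_measurable_version {Z : Type*} [MeasurableSpace Z] {σ : Measure Z}
    {κ : Z → ℝ} (hκ : MemLp κ ∞ σ) {M : ℝ} (hM0 : 0 ≤ M) (hM : ∀ᵐ z ∂σ, κ z ≤ M) :
    ∃ (κ₀ : Z → ℝ) (K : ℝ), Measurable κ₀ ∧ κ =ᵐ[σ] κ₀ ∧ (∀ z, -K ≤ κ₀ z) ∧
      ∀ z, κ₀ z ≤ M := by
  have hfin : eLpNormEssSup κ σ ≠ ∞ := by
    simpa only [eLpNorm_exponent_top] using hκ.2.ne
  set K := (eLpNormEssSup κ σ).toReal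
  have hK0 : 0 ≤ K := ENNReal.toReal_nonneg
  refine ⟨fun z => min M (max (-K) (hκ.1.mk κ z)), K,
    measurable_const.min (measurable_const.max hκ.1.stronglyMeasurable_mk.measurable), ?_,
    fun z => le_min (by linarith) (le_max_left _ _), fun z => min_le_left _ _⟩
  filter_upwards [hκ.1.ae_eq_mk, hM, ae_le_eLpNormEssSup (f := κ) (μ := σ)] with z h1 h2 h3
  have h4 := ENNReal.toReal_mono hfin h3
  rw [toReal_enorm] at h4
  rw [← h1, max_eq_right (neg_le_of_abs_le h4), min_eq_right h2]

theorem costMeasure_congr {μ₀ : Measure X} {μ₁ : Measure Y} {k l : X × Y → ℝ}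
    (h : k =ᵐ[μ₀.prod μ₁] l) : costMeasure μ₀ μ₁ k = costMeasure μ₀ μ₁ l := by
  refine withDensity_congr_ae ?_
  filter_upwards [h] with z hz
  rw [hz]

theorem measurable_ofReal_exp_neg {Z : Type*} [MeasurableSpace Z] {k : Z → ℝ}
    (hk : Measurable k) : Measurable fun z => ENNReal.ofReal (Real.exp (-k z)) :=
  (Real.measurable_exp.comp hk.neg).ennreal_ofReal

theorem costMeasure_absolutelyContinuous (μ₀ : Measure X) (μ₁ : Measure Y) (k : X × Y → ℝ) :
    costMeasure μ₀ μ₁ k ≪ μ₀.prod μ₁ :=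
  withDensity_absolutelyContinuous _ _

theorem hellingerDist_costMeasure {μ₀ : Measure X} {μ₁ : Measure Y} [IsProbabilityMeasure μ₀]
    [IsProbabilityMeasure μ₁] {k l : X × Y → ℝ} (hk : Measurable k) (hl : Measurable l)
    [IsFiniteMeasure (costMeasure μ₀ μ₁ k)] [IsFiniteMeasure (costMeasure μ₀ μ₁ l)] :
    hellingerDist (costMeasure μ₀ μ₁ k) (costMeasure μ₀ μ₁ l) =
      Real.sqrt (∫ z, (Real.exp (-k z / 2) - Real.exp (-l z / 2)) ^ 2 ∂(μ₀.prod μ₁)) := by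
  rw [hellingerDist_eq_hellingerIntegral (μ₀.prod μ₁) _ _
    (costMeasure_absolutelyContinuous _ _ _) (costMeasure_absolutelyContinuous _ _ _),
    hellingerIntegral]
  congr 1
  refine integral_congr_ae ?_
  filter_upwards [Measure.rnDeriv_withDensity (μ₀.prod μ₁) (measurable_ofReal_exp_neg hk),
    Measure.rnDeriv_withDensity (μ₀.prod μ₁) (measurable_ofReal_exp_neg hl)] with z h1 h2
  simp only [costMeasure]
  rw [h1, h2, ENNReal.toReal_ofReal (Real.exp_pos _).le, ENNReal.toReal_ofReal (Real.exp_pos _).le,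
    Real.exp_half, Real.exp_half]

theorem integral_costMeasure {μ₀ : Measure X} {μ₁ : Measure Y} {k : X × Y → ℝ}
    (hk : Measurable k) (f : X × Y → ℝ) :
    ∫ z, f z ∂(costMeasure μ₀ μ₁ k) = ∫ z, f z * Real.exp (-k z) ∂(μ₀.prod μ₁) := by
  rw [costMeasure, integral_withDensity_eq_integral_toReal_smul₀
    (measurable_ofReal_exp_neg hk).aemeasurable
    (ae_of_all _ fun z => ENNReal.ofReal_lt_top)]
  simp only [ENNReal.toReal_ofReal (Real.exp_pos _).le,
    smul_eq_mul, mul_comm]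

/-- The stability estimate for two couplings in Schrödinger form, with potentials whose sums are
bounded by `2 * M`. -/
theorem hellingerDist_le_of_potentials {μ₀ : Measure X} {μ₁ : Measure Y}
    [IsProbabilityMeasure μ₀] [IsProbabilityMeasure μ₁] {k l : X × Y → ℝ} (hk : Measurable k)
    (hl : Measurable l) {K M : ℝ} (hkK : ∀ z, |k z| ≤ K) (hlK : ∀ z, |l z| ≤ K)
    [IsFiniteMeasure (costMeasure μ₀ μ₁ k)] [IsFiniteMeasure (costMeasure μ₀ μ₁ l)]
    {φ φ' : X → ℝ} {ψ ψ' : Y → ℝ} {C : ℝ} (hφ : Measurable φ) (hφ' : Measurable φ')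
    (hψ : Measurable ψ) (hψ' : Measurable ψ') (hφC : ∀ x, |φ x| ≤ C) (hφ'C : ∀ x, |φ' x| ≤ C)
    (hψC : ∀ y, |ψ y| ≤ C) (hψ'C : ∀ y, |ψ' y| ≤ C) (hM : ∀ x y, φ x + ψ y ≤ 2 * M)
    (hM' : ∀ x y, φ' x + ψ' y ≤ 2 * M)
    (hπ : IsCoupling (costMeasure μ₀ μ₁ fun z => k z - (φ z.1 + ψ z.2)) μ₀ μ₁)
    (hπ' : IsCoupling (costMeasure μ₀ μ₁ fun z => l z - (φ' z.1 + ψ' z.2)) μ₀ μ₁) :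
    hellingerDist (costMeasure μ₀ μ₁ fun z => k z - (φ z.1 + ψ z.2))
        (costMeasure μ₀ μ₁ fun z => l z - (φ' z.1 + ψ' z.2)) ≤
      Real.exp M * hellingerDist (costMeasure μ₀ μ₁ k) (costMeasure μ₀ μ₁ l) := by
  have := hπ.isProbabilityMeasure
  have := hπ'.isProbabilityMeasure
  have mf : Measurable fun z : X × Y => φ z.1 + ψ z.2 :=
    (hφ.comp measurable_fst).add (hψ.comp measurable_snd)
  have mg : Measurable fun z : X × Y => φ' z.1 + ψ' z.2 :=
    (hφ'.comp measurable_fst).add (hψ'.comp measurable_snd)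
  have mkf : Measurable fun z : X × Y => k z - (φ z.1 + ψ z.2) := hk.sub mf
  have mlg : Measurable fun z : X × Y => l z - (φ' z.1 + ψ' z.2) := hl.sub mg
  rw [hellingerDist_costMeasure mkf mlg, hellingerDist_costMeasure hk hl]
  set σ := μ₀.prod μ₁
  have bexp : ∀ {m : X × Y → ℝ} {B : ℝ}, Measurable m → (∀ z, |m z| ≤ B) →
      MemLp (fun z => Real.exp (m z)) ∞ σ := by
    intro m B hm hB
    refine memLp_top_of_bound (Real.measurable_exp.comp hm).aestronglyMeasurable (Real.exp B)
      (ae_of_all _ fun z => ?_)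
    rw [Real.norm_of_nonneg (Real.exp_pos _).le]
    exact Real.exp_le_exp.2 ((le_abs_self _).trans (hB z))
  have bsq : ∀ {m m' : X × Y → ℝ} {B : ℝ}, Measurable m → Measurable m' → (∀ z, |m z| ≤ B) →
      (∀ z, |m' z| ≤ B) →
      Integrable (fun z => (Real.exp (-m z / 2) - Real.exp (-m' z / 2)) ^ 2) σ := by
    intro m m' B hm hm' hB hB'
    have hb : ∀ {m : X × Y → ℝ}, Measurable m → (∀ z, |m z| ≤ B) →
        MemLp (fun z => Real.exp (-m z / 2)) ∞ σ := fun {m} hm hB =>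
      bexp (B := B / 2) (hm.neg.div_const 2) fun z => by
        rw [abs_div, abs_neg, abs_two]
        exact div_le_div_of_nonneg_right (hB z) two_pos.le
    exact (((hb hm hB).sub (hb hm' hB')).mono_exponent le_top).integrable_sq
  have iφ : Integrable (fun x => φ x - φ' x) μ₀ :=
    (Integrable.of_bound hφ.aestronglyMeasurable C (ae_of_all _ hφC)).sub
      (Integrable.of_bound hφ'.aestronglyMeasurable C (ae_of_all _ hφ'C))
  have iψ : Integrable (fun y => ψ y - ψ' y) μ₁ :=
    (Integrable.of_bound hψ.aestronglyMeasurable C (ae_of_all _ hψC)).sub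
      (Integrable.of_bound hψ'.aestronglyMeasurable C (ae_of_all _ hψ'C))
  have hfC : ∀ z : X × Y, |k z - (φ z.1 + ψ z.2)| ≤ K + (C + C) := fun z =>
    (abs_sub _ _).trans (add_le_add (hkK z) ((abs_add_le _ _).trans (add_le_add (hφC _) (hψC _))))
  have hgC : ∀ z : X × Y, |l z - (φ' z.1 + ψ' z.2)| ≤ K + (C + C) := fun z =>
    (abs_sub _ _).trans
      (add_le_add (hlK z) ((abs_add_le _ _).trans (add_le_add (hφ'C _) (hψ'C _))))
  set F : X × Y → ℝ := fun z => (φ z.1 - φ' z.1) + (ψ z.2 - ψ' z.2) with hF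
  have hFm : MemLp F ∞ σ := by
    refine memLp_top_of_bound (C := (C + C) + (C + C))
      (((hφ.sub hφ').comp measurable_fst).add
        ((hψ.sub hψ').comp measurable_snd)).aestronglyMeasurable (ae_of_all _ fun z => ?_)
    exact (abs_add_le _ _).trans (add_le_add
      ((abs_sub _ _).trans (add_le_add (hφC _) (hφ'C _)))
      ((abs_sub _ _).trans (add_le_add (hψC _) (hψ'C _))))
  have iFp : Integrable (fun z => F z * Real.exp (-(k z - (φ z.1 + ψ z.2)))) σ :=
    ((bexp mkf.neg (by simpa only [Pi.neg_apply, abs_neg] using hfC)).mul hFm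
      (r := ∞)).integrable le_top
  have iFq : Integrable (fun z => F z * Real.exp (-(l z - (φ' z.1 + ψ' z.2)))) σ :=
    ((bexp mlg.neg (by simpa only [Pi.neg_apply, abs_neg] using hgC)).mul hFm
      (r := ∞)).integrable le_top
  -- `F` is a sum of one-variable functions, so its integral is the same for all couplings of `μ₀`
  -- and `μ₁`.
  have horth : ∫ z, F z * Real.exp (-(k z - (φ z.1 + ψ z.2))) ∂σ =
      ∫ z, F z * Real.exp (-(l z - (φ' z.1 + ψ' z.2))) ∂σ := by
    rw [← integral_costMeasure mkf, ← integral_costMeasure mlg, hπ.integral_add iφ iψ,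
      hπ'.integral_add iφ iψ]
  have main : ∫ z, (Real.exp (-(k z - (φ z.1 + ψ z.2)) / 2) -
        Real.exp (-(l z - (φ' z.1 + ψ' z.2)) / 2)) ^ 2 ∂σ ≤
      Real.exp (2 * M) * ∫ z, (Real.exp (-k z / 2) - Real.exp (-l z / 2)) ^ 2 ∂σ := by
    have hsq := bsq hk hl hkK hlK
    have i1 : Integrable (fun z => (1 / 2) * (F z * Real.exp (-(k z - (φ z.1 + ψ z.2))) -
        F z * Real.exp (-(l z - (φ' z.1 + ψ' z.2))))) σ := (iFp.sub iFq).const_mul _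
    calc _ ≤ ∫ z, ((1 / 2) * (F z * Real.exp (-(k z - (φ z.1 + ψ z.2))) -
          F z * Real.exp (-(l z - (φ' z.1 + ψ' z.2)))) +
          Real.exp (2 * M) * (Real.exp (-k z / 2) - Real.exp (-l z / 2)) ^ 2) ∂σ := by
          refine integral_mono (bsq mkf mlg hfC hgC) (i1.add (hsq.const_mul _)) fun z => ?_
          have := sq_exp_sub_exp_le (k z) (l z) (hM z.1 z.2) (hM' z.1 z.2)
          simp only [hF, neg_sub]
          linarith
      _ = _ := by
          rw [MeasureTheory.integral_add i1 (hsq.const_mul _), integral_const_mul,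
            integral_sub iFp iFq, horth, sub_self, mul_zero, zero_add, integral_const_mul]
  calc _ ≤ Real.sqrt (Real.exp (2 * M) *
        ∫ z, (Real.exp (-k z / 2) - Real.exp (-l z / 2)) ^ 2 ∂σ) := Real.sqrt_le_sqrt main
    _ = _ := by
        rw [Real.sqrt_mul (Real.exp_pos _).le, ← Real.exp_half, mul_div_cancel_left₀ _ two_ne_zero]

end Stability

/-! ### The stability theorem -/

theorem mainTheorem3 {X Y : Type*} [MeasurableSpace X] [MeasurableSpace Y]
    (μ₀ : Measure X) (μ₁ : Measure Y) [IsProbabilityMeasure μ₀] [IsProbabilityMeasure μ₁]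
    (κ κ' : X × Y → ℝ) (hκ : MemLp κ ∞ (μ₀.prod μ₁)) (hκ' : MemLp κ' ∞ (μ₀.prod μ₁))
    (R R' : Measure (X × Y)) [IsProbabilityMeasure R] [IsProbabilityMeasure R']
    (hR : R = costMeasure μ₀ μ₁ κ) (hR' : R' = costMeasure μ₀ μ₁ κ') :
    (∃! π : Measure (X × Y), IsStaticSchrodingerBridge μ₀ μ₁ R π) ∧
    (∃! π' : Measure (X × Y), IsStaticSchrodingerBridge μ₀ μ₁ R' π') ∧
    ∀ π π' : Measure (X × Y), IsStaticSchrodingerBridge μ₀ μ₁ R π →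
      IsStaticSchrodingerBridge μ₀ μ₁ R' π' →
      hellingerDist π π' ≤
        Real.exp (3 / 2 * max (posPartSupNorm (μ₀.prod μ₁) κ) (posPartSupNorm (μ₀.prod μ₁) κ')) *
          hellingerDist R R' := by
  set M := max (posPartSupNorm (μ₀.prod μ₁) κ) (posPartSupNorm (μ₀.prod μ₁) κ')
  have hM0 : 0 ≤ M := le_max_of_le_left ENNReal.toReal_nonneg
  obtain ⟨k, K, hk, hkκ, hkK, hkM⟩ := exists_bounded_measurable_version hκ hM0
    ((ae_le_posPartSupNorm hκ).mono fun z hz => hz.trans (le_max_left _ _))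
  obtain ⟨l, L, hl, hlκ, hlL, hlM⟩ := exists_bounded_measurable_version hκ' hM0
    ((ae_le_posPartSupNorm hκ').mono fun z hz => hz.trans (le_max_right _ _))
  rw [costMeasure_congr hkκ] at hR
  rw [costMeasure_congr hlκ] at hR'
  subst hR hR'
  obtain ⟨φ, ψ, C, hφ, hψ, hφC, hψC, hle, hπ, hiff⟩ :=
    exists_schrodinger_potentials μ₀ μ₁ hk hkK hkM
  obtain ⟨φ', ψ', C', hφ', hψ', hφC', hψC', hle', hπ', hiff'⟩ :=
    exists_schrodinger_potentials μ₀ μ₁ hl hlL hlM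
  refine ⟨⟨_, (hiff _).2 rfl, fun H hH => (hiff H).1 hH⟩,
    ⟨_, (hiff' _).2 rfl, fun H hH => (hiff' H).1 hH⟩, fun π π' h h' => ?_⟩
  rw [(hiff π).1 h, (hiff' π').1 h']
  have habs : ∀ {m : X × Y → ℝ} {B : ℝ}, (∀ z, -B ≤ m z) → (∀ z, m z ≤ M) →
      B ≤ max K L → ∀ z, |m z| ≤ max (max K L) M := fun h1 h2 hB z => abs_le'.2
    ⟨(h2 z).trans (le_max_right _ _), (neg_le.1 (h1 z)).trans (hB.trans (le_max_left _ _))⟩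
  refine (hellingerDist_le_of_potentials hk hl
    (habs hkK hkM (le_max_left _ _)) (habs hlL hlM (le_max_right _ _)) hφ hφ' hψ hψ'
    (fun x => (hφC x).trans (le_max_left C C')) (fun x => (hφC' x).trans (le_max_right C C'))
    (fun y => (hψC y).trans (le_max_left C C')) (fun y => (hψC' y).trans (le_max_right C C'))
    hle hle' hπ hπ').trans ?_
  -- The estimate obtained has the factor `exp M`; since `0 ≤ M`, it is at most `exp (3 / 2 * M)`.
  refine mul_le_mul_of_nonneg_right (Real.exp_le_exp.2 (by linarith)) (Real.sqrt_nonneg _)
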